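/- Let $(R,\mathfrak m,k)$ be a Noetherian local (commutative) ring and let $E$ be an injective hull of $k$. For a free $R$-module $F$ and a submodule $K\subseteq F$, let $K^-_F$ be the set of $x\in F$ that, as elements of $F=\operatorname{Sym}^1_R(F)$, are integral over the $R$-subalgebra of $\operatorname{Sym}_R(F)$ generated by $K$. For an $R$-module $M$, choose a surjection $\pi\colon F\to M$ from a free module; the liftable integral closure of $0$ in $M$ is $\operatorname{lic}(0,M):=\pi\big((\ker\pi)^-_F\big)$, which does not depend on $\pi$. For an ideal $I$ let $\bar I$ be its integral closure, the set of $x\in R$ with $x^n+a_1x^{n-1}+\dots+a_n=0$ for some $n\ge 1$ and $a_i\in I^i$. A parameter ideal that is $\mathfrak m$-primary is an $\mathfrak m$-primary ideal generated by $\dim R$ elements. The ring $R$ is approximately Gorenstein if there is a sequence $(I_t)_{t\in\mathbb N}$ of irreducible $\mathfrak m$-primary ideals such that every power $\mathfrak m^N$ contains some $I_t$. Put $$\tau_{\mathcal M}:=\bigcap_{M\text{ Artinian}}\operatorname{ann}_R\operatorname{lic}(0,M),\qquad \tau_{\mathcal I}:=\bigcap_{I\text{ ideal of }R}(I:_R\bar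 I).$$ Then: 1. $\displaystyle\tau_{\mathcal M}=\bigcap_{M\text{ of finite length}}\operatorname{ann}_R\operatorname{lic}(0,M)=\bigcap_{M\text{ finitely generated}}\operatorname{ann}_R\operatorname{lic}(0,M)=\operatorname{ann}_R\operatorname{lic}(0,E)$, the intersections being over all $R$-modules $M$ of the specified type. 2. $\displaystyle\tau_{\mathcal I}=\bigcap_{I\ \mathfrak m\text{-primary}}(I:_R\bar I)$. 3. $\displaystyle\tau_{\mathcal I}\subseteq\bigcap_{J\ \mathfrak m\text{-primary parameter ideal}}(J:_R\bar J)$, with equality if $k$ is infinite. 4. $\tau_{\mathcal M}\subseteq\tau_{\mathcal I}$, with equality if $\dim R=0$ or $R$ is approximately Gorenstein. -/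

import Mathlib

universe u v w

namespace LiftableClosure

section Closures

variable {R : Type u} [CommRing R]

/-- The integral closure of a submodule `L` of a (free) module `F`: the degree-one part of the
integral closure, in the symmetric algebra of `F`, of the `R`-subalgebra generated by `L`. -/
noncomputable def freeClosure {F : Type v} [AddCommGroup F] [Module R F] (L : Submodule R F) :
    Submodule R F where
  carrier := {x | IsIntegral (Algebra.adjoin R (SymmetricAlgebra.ι R F '' (L : Set F)))
    (SymmetricAlgebra.ι R F x)}
  add_mem' {x y} hx hy := by
    simp only [Set.mem_ofPred_eq, map_add] at *
    exact hx.add hy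
  zero_mem' := by
    simp only [Set.mem_ofPred_eq, map_zero]
    exact isIntegral_zero
  smul_mem' r x hx := by
    simp only [Set.mem_ofPred_eq, map_smul] at *
    exact hx.smul r

/-- The liftable integral closure of `L` in `M`: take the surjection `π` onto `M` from the free
module on the underlying set of `M`, and push forward the integral closure of `π⁻¹(L)`.
By `lic_eq_of_surjective` below, every surjection from a free module gives the same result. -/
noncomputable def lic {M : Type v} [AddCommGroup M] [Module R M] (L : Submodule R M) :
    Submodule R M :=
  (freeClosure (L.comap (Finsupp.linearCombination R (id : M → M)))).map
    (Finsupp.linearCombination R (id : M → M))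

theorem freeClosure_map_le {F : Type v} {G : Type w} [AddCommGroup F] [Module R F]
    [AddCommGroup G] [Module R G] (g : F →ₗ[R] G) (K : Submodule R F) (V : Submodule R G)
    (h : K ≤ V.comap g) {x : F} (hx : x ∈ freeClosure K) : g x ∈ freeClosure V := by
  let φ : SymmetricAlgebra R F →ₐ[R] SymmetricAlgebra R G :=
    SymmetricAlgebra.lift (SymmetricAlgebra.ι R G ∘ₗ g)
  have hφ : ∀ y, φ (SymmetricAlgebra.ι R F y) = SymmetricAlgebra.ι R G (g y) := fun y => by
    simp [φ]
  have hle : Algebra.adjoin R (SymmetricAlgebra.ι R F '' (K : Set F)) ≤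
      (Algebra.adjoin R (SymmetricAlgebra.ι R G '' (V : Set G))).comap φ := by
    refine Algebra.adjoin_le ?_
    rintro _ ⟨k, hk, rfl⟩
    exact Algebra.subset_adjoin ⟨g k, h hk, (hφ k).symm⟩
  let ψ : Algebra.adjoin R (SymmetricAlgebra.ι R F '' (K : Set F)) →+*
      Algebra.adjoin R (SymmetricAlgebra.ι R G '' (V : Set G)) :=
    ((φ.comp (Subalgebra.val _)).codRestrict _ fun a => hle a.2).toRingHom
  have key := IsIntegral.map_of_comp_eq ψ φ.toRingHom rfl
    (show IsIntegral _ (SymmetricAlgebra.ι R F x) from hx)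
  change IsIntegral _ (SymmetricAlgebra.ι R G (g x))
  rw [← hφ]
  exact key

/-- The liftable integral closure may be computed from any surjection from a free module. -/
theorem lic_eq_of_surjective {M : Type v} [AddCommGroup M] [Module R M] (L : Submodule R M)
    {F : Type w} [AddCommGroup F] [Module R F] [Module.Free R F] (p : F →ₗ[R] M)
    (hp : Function.Surjective p) : lic L = (freeClosure (L.comap p)).map p := by
  have main : ∀ {F₁ : Type (max u v)} {F₂ : Type w} [AddCommGroup F₁] [Module R F₁]
      [AddCommGroup F₂] [Module R F₂] [Module.Free R F₁] [Module.Free R F₂]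
      (p₁ : F₁ →ₗ[R] M) (p₂ : F₂ →ₗ[R] M) (_ : Function.Surjective p₁)
      (_ : Function.Surjective p₂),
      (freeClosure (L.comap p₁)).map p₁ = (freeClosure (L.comap p₂)).map p₂ := by
    intro F₁ F₂ _ _ _ _ _ _ p₁ p₂ h₁ h₂
    obtain ⟨g, hg⟩ := Module.projective_lifting_property p₂ p₁ h₂
    obtain ⟨d, hd⟩ := Module.projective_lifting_property p₁ p₂ h₁
    apply le_antisymm
    · rintro _ ⟨y, hy, rfl⟩
      refine ⟨g y, freeClosure_map_le g _ _ ?_ hy, congr($hg y)⟩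
      rw [← Submodule.comap_comp, hg]
    · rintro _ ⟨y, hy, rfl⟩
      refine ⟨d y, freeClosure_map_le d _ _ ?_ hy, congr($hd y)⟩
      rw [← Submodule.comap_comp, hd]
  refine main (Finsupp.linearCombination R (id : M → M)) p (fun m => ?_) hp
  exact ⟨Finsupp.single m 1, by simp⟩

/-- The integral closure of an ideal `I`: all `x` with an equation
`xⁿ + a₁ xⁿ⁻¹ + ⋯ + aₙ = 0`, where `n ≥ 1` and `aᵢ ∈ Iⁱ`. -/
def idealClosure (I : Ideal R) : Set R :=
  {x | ∃ n : ℕ, 0 < n ∧ ∃ a : ℕ → R, (∀ i ∈ Finset.Icc 1 n, a i ∈ I ^ i) ∧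
    x ^ n + ∑ i ∈ Finset.Icc 1 n, a i * x ^ (n - i) = 0}

/-- `f : N → E` exhibits `E` as an injective hull of `N`: `E` is injective, `f` is injective and
its image is an essential submodule of `E`. -/
structure IsInjectiveHull {N E : Type u} [AddCommGroup N] [Module R N] [AddCommGroup E]
    [Module R E] (f : N →ₗ[R] E) : Prop where
  module_injective : Module.Injective R E
  injective : Function.Injective f
  essential : ∀ S : Submodule R E, S ⊓ LinearMap.range f = ⊥ → S = ⊥

end Closures

section TestIdeals

variable (R : Type u) [CommRing R]

/-- The ideal `τ_M`: the intersection of the annihilators of the liftable integral closure of `0`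
in `M`, over all artinian modules `M`. -/
noncomputable def tauM : Ideal R :=
  ⨅ (M : Type u) (_ : AddCommGroup M) (_ : Module R M) (_ : IsArtinian R M),
    (lic (⊥ : Submodule R M)).annihilator

/-- The ideal `τ_I`: the intersection of `(I : Ī)` over all ideals `I`. -/
noncomputable def tauI : Ideal R :=
  ⨅ I : Ideal R, I.colon (idealClosure I)

variable {R} [IsLocalRing R]

/-- `I` is primary to the maximal ideal. -/
def IsMPrimary (I : Ideal R) : Prop :=
  I.IsPrimary ∧ I.radical = IsLocalRing.maximalIdeal R

/-- `J` is a maximal-ideal-primary parameter ideal: it is primary to the maximal ideal and is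
generated by `dim R` elements (that is, by a full system of parameters). -/
def IsMPrimaryParameterIdeal (J : Ideal R) : Prop :=
  IsMPrimary J ∧ ∃ (d : ℕ) (x : Fin d → R),
    ringKrullDim R = d ∧ J = Ideal.span (Set.range x)

variable (R) in
/-- `R` is approximately Gorenstein: there is a sequence of irreducible ideals, primary to the
maximal ideal, that are contained in arbitrarily high powers of the maximal ideal. -/
def IsApproximatelyGorenstein : Prop :=
  ∃ I : ℕ → Ideal R, (∀ t, InfIrred (I t) ∧ IsMPrimary (I t)) ∧
    ∀ N : ℕ, ∃ t : ℕ, I t ≤ IsLocalRing.maximalIdeal R ^ N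

end TestIdeals

end LiftableClosure

namespace LiftableClosure

open IsLocalRing

/-! ### Functoriality and finiteness of the liftable integral closure -/

section Functoriality

variable {R : Type u} [CommRing R]

/-! `lic ⊥` is functorial, and each of its elements already lies in `lic ⊥` of a finitely generated
submodule. With Krull's intersection theorem, an element killing `lic ⊥` of all finite length
modules therefore kills it for all modules (`smul_lic_bot_eq_zero_of_isFiniteLength`). The injective
hull of the residue field detects nonzero elements, so it suffices as a single test module.

For cyclic modules `lic ⊥` is the closure of `I` modulo `I` (`mk_mem_lic_bot_iff`), whence `tauM ≤
tauI`. In dimension zero, `tauI` kills the nilpotent maximal ideal `m`, while `lic ⊥` lies in `m M`.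
In the approximately Gorenstein case, `R ⧸ I t` is self-injective and detects nonzero elements of
its modules, so cyclic test modules suffice.

For parameter ideals with infinite residue field, an `m`-primary ideal with more than `dim R`
generators satisfies a form with a unit coefficient, by growth of lengths
(`exists_monomialSum_eq_zero`). A change of generators turns this form into a reduction with one
generator fewer (`exists_reduction_of_monomialSum_eq_zero`), and reductions preserve integral
closure. -/

theorem map_lic_bot_le {M : Type v} {N : Type w} [AddCommGroup M] [Module R M]
    [AddCommGroup N] [Module R N] (f : M →ₗ[R] N) {x : M} (hx : x ∈ lic (⊥ : Submodule R M)) :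
    f x ∈ lic (⊥ : Submodule R N) := by
  obtain ⟨y, hy, rfl⟩ := hx
  have hcomp : ∀ z : M →₀ R, Finsupp.linearCombination R (id : N → N)
      (Finsupp.lmapDomain R R f z) = f (Finsupp.linearCombination R (id : M → M) z) := by
    intro z
    rw [Finsupp.lmapDomain_apply, Finsupp.linearCombination_mapDomain,
      Finsupp.apply_linearCombination]
    rfl
  refine ⟨Finsupp.lmapDomain R R f y, freeClosure_map_le _ _ _ ?_ hy, hcomp y⟩
  intro z hz
  simp only [Submodule.mem_comap, Submodule.mem_bot] at hz ⊢
  rw [hcomp, hz, map_zero]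

theorem le_freeClosure {F : Type v} [AddCommGroup F] [Module R F] (K : Submodule R F) :
    K ≤ freeClosure K := fun x hx =>
  isIntegral_algebraMap (x := (⟨_, Algebra.subset_adjoin ⟨x, hx, rfl⟩⟩ :
    Algebra.adjoin R (SymmetricAlgebra.ι R F '' (K : Set F))))

/-- An element of an adjoined subalgebra lies in the subalgebra adjoined by the image of a
finitely generated submodule. -/
theorem exists_fg_mem_adjoin {F : Type v} [AddCommGroup F] [Module R F] {A : Type w} [CommRing A]
    [Algebra R A] (f : F →ₗ[R] A) (K : Submodule R F) {a : A}
    (ha : a ∈ Algebra.adjoin R (f '' (K : Set F))) :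
    ∃ K' : Submodule R F, K'.FG ∧ K' ≤ K ∧ a ∈ Algebra.adjoin R (f '' (K' : Set F)) := by
  have mono : ∀ {K₁ K₂ : Submodule R F}, K₁ ≤ K₂ →
      Algebra.adjoin R (f '' (K₁ : Set F)) ≤ Algebra.adjoin R (f '' (K₂ : Set F)) :=
    fun h => Algebra.adjoin_mono (Set.image_mono h)
  induction ha using Algebra.adjoin_induction with
  | mem x hx =>
    obtain ⟨y, hy, rfl⟩ := hx
    exact ⟨Submodule.span R {y}, Submodule.fg_span_singleton y, by simpa using hy,
      Algebra.subset_adjoin ⟨y, Submodule.mem_span_singleton_self y, rfl⟩⟩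
  | algebraMap r => exact ⟨⊥, Submodule.fg_bot, bot_le, Subalgebra.algebraMap_mem _ r⟩
  | add x y _ _ hx hy =>
    obtain ⟨K₁, h₁, h₁', hx⟩ := hx
    obtain ⟨K₂, h₂, h₂', hy⟩ := hy
    exact ⟨K₁ ⊔ K₂, h₁.sup h₂, sup_le h₁' h₂',
      add_mem (mono le_sup_left hx) (mono le_sup_right hy)⟩
  | mul x y _ _ hx hy =>
    obtain ⟨K₁, h₁, h₁', hx⟩ := hx
    obtain ⟨K₂, h₂, h₂', hy⟩ := hy
    exact ⟨K₁ ⊔ K₂, h₁.sup h₂, sup_le h₁' h₂',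
      mul_mem (mono le_sup_left hx) (mono le_sup_right hy)⟩

/-- An integral equation has finitely many coefficients, each a polynomial in finitely many elements
of `K`. -/
theorem exists_fg_mem_freeClosure {F : Type v} [AddCommGroup F] [Module R F]
    {K : Submodule R F} {x : F} (hx : x ∈ freeClosure K) :
    ∃ K' : Submodule R F, K'.FG ∧ K' ≤ K ∧ x ∈ freeClosure K' := by
  obtain ⟨p, hp, hpx⟩ := (show IsIntegral _ (SymmetricAlgebra.ι R F x) from hx)
  choose T hT using fun i => exists_fg_mem_adjoin (SymmetricAlgebra.ι R F) K (p.coeff i).2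
  let K' : Submodule R F := p.support.sup T
  have hle : ∀ i, ((p.coeff i : SymmetricAlgebra R F)) ∈
      Algebra.adjoin R (SymmetricAlgebra.ι R F '' (K' : Set F)) := by
    intro i
    by_cases hi : i ∈ p.support
    · exact Algebra.adjoin_mono (Set.image_mono (Finset.le_sup (f := T) hi)) (hT i).2.2
    · rw [Polynomial.notMem_support_iff.1 hi]
      exact zero_mem _
  refine ⟨K', Submodule.fg_finset_sup _ _ fun i _ => (hT i).1,
    Finset.sup_le fun i _ => (hT i).2.1, ?_⟩
  -- The equation descends to the smaller subalgebra by viewing it over the symmetric algebra and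
  -- lifting it back as a monic polynomial.
  let q : Polynomial (SymmetricAlgebra R F) := p.map (algebraMap _ _)
  have hq : q ∈ Polynomial.lifts (algebraMap
      (Algebra.adjoin R (SymmetricAlgebra.ι R F '' (K' : Set F))) (SymmetricAlgebra R F)) := by
    rw [Polynomial.lifts_iff_coeff_lifts]
    intro n
    refine ⟨⟨_, hle n⟩, ?_⟩
    rw [Polynomial.coeff_map]
    rfl
  obtain ⟨s, hs, -, hsm⟩ := Polynomial.lifts_and_natDegree_eq_and_monic hq (hp.map _)
  refine ⟨s, hsm, ?_⟩
  rw [← Polynomial.eval_map, hs, Polynomial.eval_map]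
  exact hpx

theorem exists_fg_mem_lic_bot {M : Type v} [AddCommGroup M] [Module R M] {x : M}
    (hx : x ∈ lic (⊥ : Submodule R M)) :
    ∃ N : Submodule R M, N.FG ∧ ∃ y ∈ lic (⊥ : Submodule R N), (y : M) = x := by
  classical
  obtain ⟨y, hy, rfl⟩ := hx
  obtain ⟨K, hK, hKle, hyK⟩ := exists_fg_mem_freeClosure hy
  obtain ⟨s, rfl⟩ := hK
  -- `T` holds every basis vector occurring in `y` or in the generators of `K`, so the projection
  -- `g` onto coordinates in `N` loses nothing.
  let T : Finset M := y.support ∪ s.biUnion Finsupp.support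
  let N : Submodule R M := Submodule.span R (T : Set M)
  have hyN : y ∈ Finsupp.supported R R (N : Set M) := fun m hm =>
    Submodule.subset_span (by simp [T] at hm ⊢; exact Or.inl hm)
  have hKN : Submodule.span R (s : Set (M →₀ R)) ≤ Finsupp.supported R R (N : Set M) := by
    refine Submodule.span_le.2 fun z hz m hm => Submodule.subset_span ?_
    simp only [T, Finset.coe_union, Finset.coe_biUnion]
    exact Or.inr (Set.mem_biUnion hz hm)
  let g : (M →₀ R) →ₗ[R] (N →₀ R) :=
    Finsupp.lcomapDomain (Subtype.val : N → M) Subtype.val_injective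
  have hg : ∀ z ∈ Finsupp.supported R R (N : Set M),
      ((Finsupp.linearCombination R (id : N → N) (g z) : N) : M) =
        Finsupp.linearCombination R (id : M → M) z := by
    intro z hz
    have h1 : Finsupp.mapDomain (Subtype.val : N → M) (g z) = z :=
      Finsupp.mapDomain_comapDomain _ Subtype.val_injective z
        fun m hm => ⟨⟨m, hz hm⟩, rfl⟩
    conv_rhs => rw [← h1, Finsupp.linearCombination_mapDomain]
    change N.subtype _ = _
    rw [Finsupp.apply_linearCombination]
    rfl
  refine ⟨N, ⟨T, rfl⟩, Finsupp.linearCombination R (id : N → N) (g y),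
    ⟨g y, freeClosure_map_le g _ _ ?_ hyK, rfl⟩, hg y hyN⟩
  intro z hz
  have := hKle hz
  simp only [Submodule.mem_comap, Submodule.mem_bot] at this ⊢
  rw [← Subtype.coe_inj, hg z (hKN hz), this]
  rfl

end Functoriality

/-! ### Integral closure of ideals and cyclic modules -/

section Ideals

variable {R : Type u} [CommRing R]

theorem mem_idealClosure_of_sum_eq_zero {I : Ideal R} {x : R} {n : ℕ} (hn : 0 < n) (c : ℕ → R)
    (hcn : c n = 1) (hc : ∀ i ≤ n, c i ∈ I ^ (n - i))
    (h : ∑ i ∈ Finset.range (n + 1), c i * x ^ i = 0) : x ∈ idealClosure I := by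
  refine ⟨n, hn, fun i => c (n - i), fun i hi => ?_, ?_⟩
  · have := hc (n - i) (Nat.sub_le _ _)
    rwa [Nat.sub_sub_self (Finset.mem_Icc.1 hi).2] at this
  · rw [Finset.sum_range_succ, hcn, one_mul, add_comm] at h
    rw [← h]
    congr 1
    refine Finset.sum_bij' (fun i _ => n - i) (fun i _ => n - i) ?_ ?_ ?_ ?_ fun i _ => rfl
    all_goals
      intro i hi
      simp only [Finset.mem_Icc, Finset.mem_range] at hi ⊢
      omega

open Polynomial in
-- The subalgebra generated by `I` maps into the Rees algebra inside `R[X]`; the degree `n` part of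
-- a monic equation of degree `n` is the required equation.
theorem mem_idealClosure_of_mem_freeClosure {I : Ideal R} {x : R} (hx : x ∈ freeClosure I) :
    x ∈ idealClosure I := by
  rcases subsingleton_or_nontrivial R with hR | hR
  · exact ⟨1, one_pos, 0, by simp, Subsingleton.elim _ _⟩
  let φ : SymmetricAlgebra R R →ₐ[R] R[X] := SymmetricAlgebra.lift (monomial 1)
  have hφ : ∀ y, φ (SymmetricAlgebra.ι R R y) = monomial 1 y := fun y => by simp [φ]
  have hle : Algebra.adjoin R (SymmetricAlgebra.ι R R '' (I : Set R)) ≤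
      (reesAlgebra I).comap φ := by
    refine Algebra.adjoin_le ?_
    rintro _ ⟨k, hk, rfl⟩
    change φ _ ∈ reesAlgebra I
    rw [hφ]
    exact reesAlgebra.monomial_mem.2 (by simpa using hk)
  obtain ⟨p, hp, hpx⟩ := (show IsIntegral _ (SymmetricAlgebra.ι R R x) from hx)
  have hsum := congr(φ $hpx)
  rw [eval₂_eq_sum_range, map_sum, map_zero] at hsum
  have hc : ∀ i j, (φ (p.coeff i : SymmetricAlgebra R R)).coeff j ∈ I ^ j := fun i =>
    (mem_reesAlgebra_iff I _).1 (hle (p.coeff i).2)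
  set n := p.natDegree with hn
  have key : ∑ i ∈ Finset.range (n + 1),
      (φ (p.coeff i : SymmetricAlgebra R R)).coeff (n - i) * x ^ i = 0 := by
    have := congr(coeff $hsum n)
    rw [finsetSum_coeff, coeff_zero] at this
    rw [← this]
    refine Finset.sum_congr rfl fun i hi => ?_
    have hi : i ≤ n := Nat.lt_succ_iff.1 (Finset.mem_range.1 hi)
    rw [map_mul, map_pow, hφ, monomial_pow, one_mul]
    conv_rhs => rw [show n = (n - i) + i by omega]
    rw [coeff_mul_monomial]
    rfl
  have hn0 : 0 < n := by
    rcases Nat.eq_zero_or_pos n with h0 | h0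
    · rw [h0] at key
      have : p = 1 := hp.natDegree_eq_zero.1 (hn ▸ h0)
      simp [this] at key
    · exact h0
  refine mem_idealClosure_of_sum_eq_zero hn0 _ ?_ (fun i _ => hc i (n - i)) key
  rw [hn, hp.coeff_natDegree]
  simp

/-- The equation is homogenised: `a i • T ^ i` lies in the subalgebra because `a i ∈ I ^ i`, and the
whole equation is multiplied by `T ^ n`. -/
theorem mem_freeClosure_of_mem_idealClosure {I : Ideal R} {x : R} (hx : x ∈ idealClosure I) :
    x ∈ freeClosure I := by
  rcases subsingleton_or_nontrivial R with hR | hR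
  · rw [Subsingleton.elim x 0]
    exact zero_mem _
  obtain ⟨n, hn, a, ha, h⟩ := hx
  set S := Algebra.adjoin R (SymmetricAlgebra.ι R R '' (I : Set R))
  set T : SymmetricAlgebra R R := SymmetricAlgebra.ι R R 1 with hT
  have hι : ∀ y, SymmetricAlgebra.ι R R y = y • T := fun y => by
    rw [hT, ← map_smul, smul_eq_mul, mul_one]
  have hS : ∀ i, ∀ y ∈ I ^ i, y • T ^ i ∈ S := by
    intro i
    induction i with
    | zero => intro y _; rw [pow_zero]; exact Subalgebra.smul_mem _ (one_mem _) _
    | succ i ih =>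
      intro y hy
      rw [pow_succ] at hy
      induction hy using Submodule.mul_induction_on' with
      | mem_mul_mem m hm k hk =>
        have : (m * k) • T ^ (i + 1) = (m • T ^ i) * (k • T) := by
          rw [smul_mul_smul_comm, pow_succ]
        rw [this]
        exact mul_mem (ih m hm) (hι k ▸ Algebra.subset_adjoin ⟨k, hk, rfl⟩)
      | add y _ z _ hy hz => rw [add_smul]; exact add_mem hy hz
  let b : ℕ → S := fun i => if hi : i ∈ Finset.Icc 1 n then ⟨a i • T ^ i, hS i _ (ha i hi)⟩ else 0
  have hb : ∀ i ∈ Finset.Icc 1 n, (b i : SymmetricAlgebra R R) = a i • T ^ i := fun i hi => by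
    simp only [b, dif_pos hi]
  have hdeg : (∑ i ∈ Finset.Icc 1 n,
      Polynomial.C (b i) * Polynomial.X ^ (n - i)).degree < (n : WithBot ℕ) := by
    refine Polynomial.mem_degreeLT.1 (sum_mem fun i hi => Polynomial.mem_degreeLT.2 ?_)
    rw [Finset.mem_Icc] at hi
    exact (Polynomial.degree_C_mul_X_pow_le _ _).trans_lt (by exact_mod_cast (by omega))
  refine ⟨Polynomial.X ^ n + ∑ i ∈ Finset.Icc 1 n, Polynomial.C (b i) * Polynomial.X ^ (n - i),
    Polynomial.monic_X_pow_add hdeg, ?_⟩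
  rw [Polynomial.eval₂_add, Polynomial.eval₂_X_pow, Polynomial.eval₂_finsetSum]
  have : ∀ i ∈ Finset.Icc 1 n, Polynomial.eval₂ (algebraMap S (SymmetricAlgebra R R))
      (SymmetricAlgebra.ι R R x) (Polynomial.C (b i) * Polynomial.X ^ (n - i)) =
      (a i * x ^ (n - i)) • T ^ n := by
    intro i hi
    rw [Polynomial.eval₂_mul, Polynomial.eval₂_C, Polynomial.eval₂_X_pow]
    change (b i : SymmetricAlgebra R R) * _ = _
    rw [hb i hi, hι, smul_pow, smul_mul_smul_comm, ← pow_add]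
    rw [Finset.mem_Icc] at hi
    rw [show i + (n - i) = n by omega]
  rw [Finset.sum_congr rfl this, ← Finset.sum_smul, hι, smul_pow, ← add_smul, h, zero_smul]

theorem mem_freeClosure_iff_mem_idealClosure {I : Ideal R} {x : R} :
    x ∈ freeClosure I ↔ x ∈ idealClosure I :=
  ⟨mem_idealClosure_of_mem_freeClosure, mem_freeClosure_of_mem_idealClosure⟩

theorem mk_mem_lic_bot_iff (I : Ideal R) (x : R) :
    Submodule.Quotient.mk x ∈ lic (⊥ : Submodule R (R ⧸ I)) ↔ x ∈ idealClosure I := by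
  rw [lic_eq_of_surjective ⊥ I.mkQ I.mkQ_surjective, ← mem_freeClosure_iff_mem_idealClosure]
  rw [show Submodule.comap I.mkQ ⊥ = I from I.ker_mkQ]
  constructor
  · rintro ⟨y, hy, hyx⟩
    have : x - y ∈ I := (Submodule.Quotient.eq I).1 hyx.symm
    simpa using add_mem (le_freeClosure I this) hy
  · exact fun h => ⟨x, h, rfl⟩

theorem idealClosure_mono {I J : Ideal R} (h : I ≤ J) : idealClosure I ⊆ idealClosure J := by
  rintro x ⟨n, hn, a, ha, hx⟩
  exact ⟨n, hn, a, fun i hi => Ideal.pow_right_mono h i (ha i hi), hx⟩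

end Ideals

/-! ### Self-injectivity of artinian rings with irreducible zero ideal -/

section SelfInjective

variable {A : Type u} [CommRing A]

/-- The images of nonzero `f` and `g` meet, so `f s = g t` with `t ≠ 0`. Writing `s = b • t` gives
`g = b • f`, since `t` generates `S`. -/
theorem isSimpleModule_hom_of_infIrred_bot (hA : InfIrred (⊥ : Ideal A)) {S : Type v}
    [AddCommGroup S] [Module A S] [IsSimpleModule A S] [Nontrivial (S →ₗ[A] A)] :
    IsSimpleModule A (S →ₗ[A] A) := by
  refine isSimpleModule_iff_toSpanSingleton_surjective.2 ⟨inferInstance, fun f hf g => ?_⟩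
  rcases eq_or_ne g 0 with rfl | hg
  · exact ⟨0, by simp⟩
  have hfi := f.injective_of_ne_zero hf
  have hgi := g.injective_of_ne_zero hg
  have hne : LinearMap.range f ⊓ LinearMap.range g ≠ ⊥ := fun h => by
    rcases hA.2 h with h | h
    · exact hf (LinearMap.range_eq_bot.1 h)
    · exact hg (LinearMap.range_eq_bot.1 h)
  obtain ⟨x, ⟨⟨s, hs⟩, ⟨t, ht⟩⟩, hx⟩ := Submodule.exists_mem_ne_zero_of_ne_bot hne
  have ht0 : t ≠ 0 := by
    rintro rfl
    exact hx (by rw [← ht, map_zero])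
  obtain ⟨b, hb⟩ := IsSimpleModule.toSpanSingleton_surjective A ht0 s
  refine ⟨b, ?_⟩
  ext y
  obtain ⟨c, rfl⟩ := IsSimpleModule.toSpanSingleton_surjective A ht0 y
  simp only [LinearMap.toSpanSingleton_apply, LinearMap.smul_apply, map_smul] at hb ⊢
  rw [ht, ← hs, ← hb, map_smul]

theorem length_hom_le_one_of_infIrred_bot (hA : InfIrred (⊥ : Ideal A)) (S : Type v)
    [AddCommGroup S] [Module A S] [IsSimpleModule A S] : Module.length A (S →ₗ[A] A) ≤ 1 := by
  rcases subsingleton_or_nontrivial (S →ₗ[A] A) with h | h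
  · simp
  · have := isSimpleModule_hom_of_infIrred_bot hA (S := S)
    rw [Module.length_eq_one]

theorem length_ker_domRestrict_le {M : Type v} {P : Type w} [AddCommGroup M] [Module A M]
    [AddCommGroup P] [Module A P] (N : Submodule A M) :
    Module.length A (LinearMap.ker (LinearMap.lcomp A P N.subtype)) ≤
      Module.length A (M ⧸ N →ₗ[A] P) := by
  refine Module.length_le_of_surjective
    ((LinearMap.lcomp A P N.mkQ).codRestrict _ fun f => ?_) ?_
  · ext x
    have : (Submodule.Quotient.mk (x : M) : M ⧸ N) = 0 := by simp
    simp [this]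
  · rintro ⟨f, hf⟩
    have hN : N ≤ LinearMap.ker f := fun x hx => congr($hf ⟨x, hx⟩)
    exact ⟨N.liftQ f hN, Subtype.ext (LinearMap.ext fun x => rfl)⟩

theorem length_eq_length_ker_add_length_range {M : Type v} {P : Type w} [AddCommGroup M]
    [Module A M] [AddCommGroup P] [Module A P] (f : M →ₗ[A] P) :
    Module.length A M =
      Module.length A (LinearMap.ker f) + Module.length A (LinearMap.range f) :=
  Module.length_eq_add_of_exact (LinearMap.ker f).subtype f.rangeRestrict
    (Submodule.subtype_injective _) f.surjective_rangeRestrict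
    (LinearMap.exact_iff.2 (by simp))

theorem length_eq_length_submodule_add_length_quotient {M : Type v} [AddCommGroup M]
    [Module A M] (N : Submodule A M) :
    Module.length A M = Module.length A N + Module.length A (M ⧸ N) :=
  Module.length_eq_add_of_exact N.subtype N.mkQ
    (Submodule.subtype_injective _) N.mkQ_surjective (LinearMap.exact_subtype_mkQ N)

/-- Induction along a composition series: each simple factor contributes at most one to the length
of the dual. -/
theorem length_hom_le_length (hA : InfIrred (⊥ : Ideal A)) {M : Type v} [AddCommGroup M]
    [Module A M] (hM : IsFiniteLength A M) : Module.length A (M →ₗ[A] A) ≤ Module.length A M := by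
  induction hM with
  | of_subsingleton => simp
  | @of_simple_quotient M _ _ N _ _ ih =>
    rw [length_eq_length_ker_add_length_range (LinearMap.lcomp A A N.subtype),
      length_eq_length_submodule_add_length_quotient N, add_comm]
    refine add_le_add ((Module.length_le_of_injective _ (Submodule.subtype_injective _)).trans ih)
      ((length_ker_domRestrict_le N).trans ?_)
    rw [Module.length_eq_one A (M ⧸ N)]
    exact length_hom_le_one_of_infIrred_bot hA _

/-- An artinian ring in which the zero ideal is irreducible is self-injective. -/
theorem injective_self_of_infIrred_bot [IsArtinianRing A] (hA : InfIrred (⊥ : Ideal A)) :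
    Module.Injective A A := by
  refine Module.Baer.injective fun J g => ?_
  have hfin : ∀ (M : Type u) [AddCommGroup M] [Module A M] [Module.Finite A M],
      IsFiniteLength A M := fun M _ _ _ =>
    isFiniteLength_iff_isNoetherian_isArtinian.2 ⟨inferInstance, inferInstance⟩
  set ρ : (A →ₗ[A] A) →ₗ[A] (J →ₗ[A] A) := LinearMap.lcomp A A J.subtype
  have hJ : Module.length A (J →ₗ[A] A) ≠ ⊤ :=
    ne_top_of_le_ne_top (Module.length_ne_top_iff.2 (hfin J)) (length_hom_le_length hA (hfin J))
  -- The dual of `A` has the length of `A`, and the kernel of restriction embeds no more than the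
  -- dual of `A ⧸ J`. Cancelling, the range of `ρ` is at least as long as `J`, hence at least as
  -- long as the dual of `J`, so `ρ` is onto and Baer's criterion applies.
  have h1 : Module.length A J + Module.length A (A ⧸ J) ≤
      Module.length A (LinearMap.range ρ) + Module.length A (A ⧸ J) := by
    rw [← length_eq_length_submodule_add_length_quotient J,
      ← (LinearMap.ringLmapEquivSelf A A A).length_eq, length_eq_length_ker_add_length_range ρ,
      add_comm]
    gcongr
    exact (length_ker_domRestrict_le J).trans (length_hom_le_length hA (hfin _))
  have h2 : Module.length A J ≤ Module.length A (LinearMap.range ρ) :=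
    (ENat.add_le_add_iff_right (Module.length_ne_top_iff.2 (hfin _))).1 h1
  have hs : LinearMap.range ρ = ⊤ := by
    by_contra hne
    obtain ⟨_, _⟩ := isFiniteLength_iff_isNoetherian_isArtinian.1 (Module.length_ne_top_iff.1 hJ)
    exact absurd ((length_hom_le_length hA (hfin J)).trans h2) (Submodule.length_lt hne).not_ge
  obtain ⟨f, hf⟩ := LinearMap.range_eq_top.1 hs g
  exact ⟨f, fun x hx => congr($hf ⟨x, hx⟩)⟩

/-- Over a local ring, an injective module with a nonzero socle is a cogenerator. -/
theorem exists_hom_apply_ne_zero [IsLocalRing A] {E : Type u} [AddCommGroup E] [Module A E]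
    (hE : Module.Injective A E) {s : E} (hs : s ≠ 0) (hms : ∀ r ∈ maximalIdeal A, r • s = 0)
    {M : Type u} [AddCommGroup M] [Module A M] {y : M} (hy : y ≠ 0) :
    ∃ φ : M →ₗ[A] E, φ y ≠ 0 := by
  set i := LinearMap.toSpanSingleton A M y
  -- The annihilator of `y` contains no unit, so it kills `s`: thus `y ↦ s` is well defined on the
  -- span of `y` and extends to `M`.
  have hle : LinearMap.ker i ≤ LinearMap.ker (LinearMap.toSpanSingleton A E s) := by
    intro r hr
    refine hms r fun hu => hy ?_
    exact (hu.smul_eq_zero).1 hr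
  obtain ⟨φ, hφ⟩ := hE.out ((LinearMap.ker i).liftQ i le_rfl)
    (LinearMap.ker_eq_bot.1 (Submodule.ker_liftQ_eq_bot _ _ _ le_rfl))
    ((LinearMap.ker i).liftQ _ hle)
  refine ⟨φ, ?_⟩
  have := hφ (Submodule.Quotient.mk 1)
  simp only [Submodule.liftQ_apply, i, LinearMap.toSpanSingleton_apply, one_smul] at this
  rwa [this]

theorem exists_hom_self_apply_ne_zero [IsArtinianRing A] [IsLocalRing A]
    (hA : InfIrred (⊥ : Ideal A)) {M : Type u} [AddCommGroup M] [Module A M] {y : M}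
    (hy : y ≠ 0) : ∃ φ : M →ₗ[A] A, φ y ≠ 0 := by
  have hnil := (isArtinianRing_iff_isNilpotent_maximalIdeal A).1 inferInstance
  classical
  -- The last nonzero power of the maximal ideal supplies the socle element.
  obtain ⟨n, hn, hmin⟩ : ∃ n, maximalIdeal A ^ n = 0 ∧ ∀ m < n, maximalIdeal A ^ m ≠ 0 :=
    ⟨Nat.find hnil, Nat.find_spec hnil, fun _ => Nat.find_min hnil⟩
  cases n with
  | zero => exact absurd hn (by simp)
  | succ n =>
    obtain ⟨s, hs, hs0⟩ := Submodule.exists_mem_ne_zero_of_ne_bot (hmin n (Nat.lt_succ_self n))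
    refine exists_hom_apply_ne_zero (injective_self_of_infIrred_bot hA) hs0 (fun r hr => ?_) hy
    have : s * r ∈ maximalIdeal A ^ (n + 1) := by
      rw [pow_succ]
      exact Ideal.mul_mem_mul hs hr
    rw [hn] at this
    rw [smul_eq_mul, mul_comm]
    exact this

theorem infIrred_bot_quotient {I : Ideal A} (hI : InfIrred I) : InfIrred (⊥ : Ideal (A ⧸ I)) := by
  have hinj := Ideal.comap_injective_of_surjective (Ideal.Quotient.mk I)
    Ideal.Quotient.mk_surjective
  have hbot : (⊥ : Ideal (A ⧸ I)).comap (Ideal.Quotient.mk I) = I := by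
    rw [← RingHom.ker_eq_comap_bot, Ideal.mk_ker]
  have hnt : Nontrivial (A ⧸ I) := Ideal.Quotient.nontrivial_iff.2 fun h => hI.1 (h ▸ isMax_top)
  refine ⟨not_isMax_bot, fun {a b} hab => ?_⟩
  have : a.comap (Ideal.Quotient.mk I) ⊓ b.comap (Ideal.Quotient.mk I) = I := by
    rw [← Ideal.comap_inf, hab, hbot]
  exact (hI.2 this).imp (fun h => hinj (h.trans hbot.symm)) (fun h => hinj (h.trans hbot.symm))

end SelfInjective

/-! ### Comparison of the test ideals -/

section TestIdeals

variable {R : Type u} [CommRing R]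

theorem mem_iInf_annihilator_iff {P : ∀ (M : Type u) [AddCommGroup M] [Module R M], Prop}
    {r : R} :
    r ∈ (⨅ (M : Type u) (_ : AddCommGroup M) (_ : Module R M) (_ : P M),
      (lic (⊥ : Submodule R M)).annihilator) ↔
    ∀ (M : Type u) [AddCommGroup M] [Module R M], P M → ∀ z ∈ lic (⊥ : Submodule R M),
      r • z = 0 := by
  simp only [Submodule.mem_iInf, Submodule.mem_annihilator]

theorem mem_tauI_iff {r : R} :
    r ∈ tauI R ↔ ∀ I : Ideal R, ∀ x ∈ idealClosure I, r * x ∈ I := by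
  simp only [tauI, Submodule.mem_iInf, Submodule.mem_colon, smul_eq_mul]

theorem smul_lic_bot_quotient_eq_zero {r : R} (hr : r ∈ tauI R) {I : Ideal R} {z : R ⧸ I}
    (hz : z ∈ lic (⊥ : Submodule R (R ⧸ I))) : r • z = 0 := by
  obtain ⟨x, rfl⟩ := Submodule.Quotient.mk_surjective I z
  rw [← Submodule.Quotient.mk_smul, Submodule.Quotient.mk_eq_zero]
  exact mem_tauI_iff.1 hr I x ((mk_mem_lic_bot_iff I x).1 hz)

variable [IsLocalRing R]

/-- An element outside would survive under some functional to the residue field, where `lic ⊥`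
vanishes because the maximal ideal, being prime, is integrally closed. -/
theorem lic_bot_le_maximalIdeal_smul (M : Type v) [AddCommGroup M] [Module R M] :
    lic (⊥ : Submodule R M) ≤ maximalIdeal R • ⊤ := by
  intro z hz
  by_contra h
  let : Field (R ⧸ maximalIdeal R) := Ideal.Quotient.field _
  obtain ⟨φ, hφ⟩ := Module.Projective.exists_dual_ne_zero (R ⧸ maximalIdeal R)
    (x := (Submodule.Quotient.mk z : M ⧸ (maximalIdeal R • ⊤ : Submodule R M)))
    (fun h0 => h ((Submodule.Quotient.mk_eq_zero _).1 h0))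
  have hmem := map_lic_bot_le (φ.restrictScalars R ∘ₗ Submodule.mkQ _) hz
  obtain ⟨x, hx⟩ := Submodule.Quotient.mk_surjective _ (φ (Submodule.Quotient.mk z))
  change φ (Submodule.Quotient.mk z) ∈ _ at hmem
  rw [← hx, mk_mem_lic_bot_iff] at hmem
  obtain ⟨n, hn, a, ha, hax⟩ := hmem
  have hxn : x ^ n ∈ maximalIdeal R := by
    rw [eq_neg_of_add_eq_zero_left hax]
    refine neg_mem (sum_mem fun i hi => Ideal.mul_mem_right _ _ ?_)
    exact Ideal.pow_le_self (Nat.one_le_iff_ne_zero.1 (Finset.mem_Icc.1 hi).1) (ha i hi)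
  refine hφ ?_
  rw [← hx, Submodule.Quotient.mk_eq_zero]
  exact Ideal.IsPrime.mem_of_pow_mem inferInstance n hxn

theorem tauI_le_tauM_of_ringKrullDim_eq_zero (h : ringKrullDim R = 0) : tauI R ≤ tauM R := by
  have : Ring.KrullDimLE 0 R := Ring.krullDimLE_iff.2 h.le
  intro r hr
  -- In dimension zero each such `x` is nilpotent, hence integral over the zero ideal.
  have hrm : ∀ x ∈ maximalIdeal R, r * x = 0 := by
    intro x hx
    obtain ⟨n, hn⟩ := Ring.KrullDimLE.isNilpotent_iff_mem_maximalIdeal.2 hx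
    refine mem_tauI_iff.1 hr ⊥ x ⟨n, Nat.pos_of_ne_zero fun h0 => ?_, 0, by simp, by simp [hn]⟩
    simp [h0] at hn
  refine mem_iInf_annihilator_iff.2 fun M _ _ _ z hz => ?_
  have hle : maximalIdeal R • (⊤ : Submodule R M) ≤ LinearMap.ker (LinearMap.lsmul R M r) :=
    Submodule.smul_le.2 fun x hx m _ => by
      rw [LinearMap.mem_ker, LinearMap.lsmul_apply, smul_smul, hrm x hx, zero_smul]
  exact hle (lic_bot_le_maximalIdeal_smul M hz)

theorem maximalIdeal_pow_sup_isMPrimary {I : Ideal R} (hI : I ≠ ⊤) (n : ℕ) (hn : n ≠ 0) :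
    IsMPrimary (I ⊔ maximalIdeal R ^ n) := by
  have hrad : (I ⊔ maximalIdeal R ^ n).radical = maximalIdeal R := by
    refine le_antisymm ?_ ?_
    · rw [(maximalIdeal.isMaximal R).isPrime.radical_le_iff]
      exact sup_le (le_maximalIdeal hI) (Ideal.pow_le_self hn)
    · intro x hx
      exact ⟨n, Ideal.mem_sup_right (Ideal.pow_mem_pow hx n)⟩
  exact ⟨Ideal.isPrimary_of_isMaximal_radical (by rw [hrad]; exact maximalIdeal.isMaximal R), hrad⟩

variable [IsNoetherianRing R]

theorem IsMPrimary.isArtinianRing {I : Ideal R} (hI : IsMPrimary I) : IsArtinianRing (R ⧸ I) := by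
  refine quotient_artinian_of_mem_minimalPrimes_of_isLocalRing I ?_
  rw [← Ideal.radical_minimalPrimes, hI.2]
  rw [Ideal.minimalPrimes_eq_subsingleton_self]
  rfl

theorem exists_notMem_maximalIdeal_pow_smul {M : Type v} [AddCommGroup M] [Module R M]
    [Module.Finite R M] {y : M} (hy : y ≠ 0) :
    ∃ n : ℕ, n ≠ 0 ∧ y ∉ (maximalIdeal R ^ n • ⊤ : Submodule R M) := by
  by_contra! h
  refine hy ((Submodule.mem_bot R).1 ?_)
  rw [← Ideal.iInf_pow_smul_eq_bot_of_isLocalRing (maximalIdeal R) (Ideal.IsPrime.ne_top'),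
    Submodule.mem_iInf]
  intro n
  rcases eq_or_ne n 0 with rfl | hn
  · simp
  · exact h n hn

theorem mem_of_forall_mem_sup_pow {I : Ideal R} {x : R}
    (h : ∀ n : ℕ, n ≠ 0 → x ∈ I ⊔ maximalIdeal R ^ n) : x ∈ I := by
  by_contra hx
  obtain ⟨n, hn, hxn⟩ := exists_notMem_maximalIdeal_pow_smul (R := R)
    (y := Submodule.Quotient.mk (p := I) x)
    (fun h => hx ((Submodule.Quotient.mk_eq_zero I).1 h))
  obtain ⟨a, ha, b, hb, rfl⟩ := Submodule.mem_sup.1 (h n hn)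
  refine hxn ?_
  have : (Submodule.Quotient.mk (a + b) : R ⧸ I) = b • Submodule.Quotient.mk 1 := by
    rw [← Submodule.Quotient.mk_smul, smul_eq_mul, mul_one, Submodule.Quotient.mk_add,
      (Submodule.Quotient.mk_eq_zero I).2 ha, zero_add]
  rw [this]
  exact Submodule.smul_mem_smul hb trivial

theorem isFiniteLength_quotient_pow_smul (M : Type v) [AddCommGroup M] [Module R M]
    [Module.Finite R M] (n : ℕ) (hn : n ≠ 0) :
    IsFiniteLength R (M ⧸ (maximalIdeal R ^ n • ⊤ : Submodule R M)) := by
  have : IsArtinianRing (R ⧸ maximalIdeal R ^ n) := by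
    have := maximalIdeal_pow_sup_isMPrimary (R := R) bot_ne_top n hn
    rw [bot_sup_eq] at this
    exact this.isArtinianRing
  have : Module.Finite (R ⧸ maximalIdeal R ^ n)
      (M ⧸ (maximalIdeal R ^ n • ⊤ : Submodule R M)) := .of_restrictScalars_finite R _ _
  exact isFiniteLength_iff_isNoetherian_isArtinian.2 ⟨inferInstance,
    isArtinian_of_surjective_algebraMap (R := R ⧸ maximalIdeal R ^ n)
      Ideal.Quotient.mk_surjective⟩

/-- If `r • y ≠ 0` in a finitely generated `N`, it survives modulo some power of the maximal ideal,
and that quotient has finite length. -/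
theorem smul_lic_bot_eq_zero_of_isFiniteLength {r : R}
    (hr : ∀ (M : Type u) [AddCommGroup M] [Module R M], IsFiniteLength R M →
      ∀ z ∈ lic (⊥ : Submodule R M), r • z = 0)
    (M : Type u) [AddCommGroup M] [Module R M] {z : M} (hz : z ∈ lic (⊥ : Submodule R M)) :
    r • z = 0 := by
  obtain ⟨N, hN, y, hy, rfl⟩ := exists_fg_mem_lic_bot hz
  have : Module.Finite R N := Module.Finite.iff_fg.2 hN
  by_contra h0
  obtain ⟨n, hn, hmem⟩ := exists_notMem_maximalIdeal_pow_smul (R := R) (y := r • y)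
    (fun h => h0 (by rw [← Submodule.coe_smul, h, Submodule.coe_zero]))
  refine hmem ((Submodule.Quotient.mk_eq_zero _).1 ?_)
  exact hr _ (isFiniteLength_quotient_pow_smul N n hn) _ (map_lic_bot_le (Submodule.mkQ _) hy)

theorem smul_lic_bot_eq_zero_of_mem_tauM {r : R} (hr : r ∈ tauM R) (M : Type u) [AddCommGroup M]
    [Module R M] {z : M} (hz : z ∈ lic (⊥ : Submodule R M)) : r • z = 0 :=
  smul_lic_bot_eq_zero_of_isFiniteLength (fun M _ _ hM => mem_iInf_annihilator_iff.1 hr M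
    (isFiniteLength_iff_isNoetherian_isArtinian.1 hM).2) M hz

/-- Any class of modules containing those of finite length gives the same intersection; this serves
both the finite length and the finitely generated case. -/
theorem tauM_eq_iInf {P : ∀ (M : Type u) [AddCommGroup M] [Module R M], Prop}
    (hP : ∀ (M : Type u) [AddCommGroup M] [Module R M], IsFiniteLength R M → P M) :
    tauM R = ⨅ (M : Type u) (_ : AddCommGroup M) (_ : Module R M) (_ : P M),
      (lic (⊥ : Submodule R M)).annihilator := by
  ext r
  rw [mem_iInf_annihilator_iff]
  exact ⟨fun hr M _ _ _ z hz => smul_lic_bot_eq_zero_of_mem_tauM hr M hz,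
    fun hr => mem_iInf_annihilator_iff.2 fun M _ _ _ z hz =>
      smul_lic_bot_eq_zero_of_isFiniteLength (fun M _ _ hM => hr M (hP M hM)) M hz⟩

theorem tauM_eq_annihilator_injectiveHull {E : Type u} [AddCommGroup E] [Module R E]
    {f : ResidueField R →ₗ[R] E} (hf : IsInjectiveHull f) :
    tauM R = (lic (⊥ : Submodule R E)).annihilator := by
  ext r
  rw [Submodule.mem_annihilator]
  refine ⟨fun hr z hz => smul_lic_bot_eq_zero_of_mem_tauM hr E hz, fun hr =>
    mem_iInf_annihilator_iff.2 fun M _ _ _ z hz => ?_⟩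
  by_contra h0
  -- `f 1` is a nonzero element of `E` killed by the maximal ideal.
  obtain ⟨φ, hφ⟩ := exists_hom_apply_ne_zero hf.module_injective (s := f 1)
    (fun h => one_ne_zero ((map_eq_zero_iff f hf.injective).1 h))
    (fun r hr => by
      rw [← map_smul, Algebra.smul_def, ResidueField.algebraMap_eq,
        (residue_eq_zero_iff r).2 hr, zero_mul, map_zero]) h0
  rw [map_smul] at hφ
  exact hφ (hr _ (map_lic_bot_le φ hz))

theorem tauM_le_tauI : tauM R ≤ tauI R := fun r hr => mem_tauI_iff.2 fun I x hx => by
  have := smul_lic_bot_eq_zero_of_mem_tauM hr (R ⧸ I) ((mk_mem_lic_bot_iff I x).2 hx)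
  rwa [← Submodule.Quotient.mk_smul, Submodule.Quotient.mk_eq_zero] at this

theorem tauI_eq_iInf_isMPrimary :
    tauI R = ⨅ (I : Ideal R) (_ : IsMPrimary I), I.colon (idealClosure I) := by
  refine le_antisymm (le_iInf fun I => le_iInf fun _ => iInf_le _ I) fun r hr => ?_
  simp only [Submodule.mem_iInf, Submodule.mem_colon, smul_eq_mul] at hr
  refine mem_tauI_iff.2 fun I x hx => ?_
  by_cases hI : I = ⊤
  · simp [hI]
  · exact mem_of_forall_mem_sup_pow fun n hn =>
      hr _ (maximalIdeal_pow_sup_isMPrimary hI n hn) x (idealClosure_mono le_sup_left hx)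

theorem tauI_le_tauM_of_isApproximatelyGorenstein (h : IsApproximatelyGorenstein R) :
    tauI R ≤ tauM R := by
  obtain ⟨I, hI, hpow⟩ := h
  intro r hr
  rw [tauM_eq_iInf (P := fun M _ _ => Module.Finite R M) fun M _ _ hM =>
    have := (isFiniteLength_iff_isNoetherian_isArtinian.1 hM).1
    inferInstance, mem_iInf_annihilator_iff]
  intro M _ _ _ z hz
  by_contra h0
  obtain ⟨n, hn, hmem⟩ := exists_notMem_maximalIdeal_pow_smul (R := R) h0
  obtain ⟨t, ht⟩ := hpow n
  -- As `I t` lies in the `n`-th power, the quotient is a module over `R ⧸ I t`; a functional `φ` to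
  -- that ring detecting `r • z` moves the question to a cyclic module.
  have htors : Module.IsTorsionBySet R (M ⧸ (maximalIdeal R ^ n • ⊤ : Submodule R M)) (I t) :=
    fun x a =>
    Module.isTorsionBySet_quotient_ideal_smul M (maximalIdeal R ^ n) (x := x) (a := ⟨a, ht a.2⟩)
  let := htors.module
  have : IsScalarTower R (R ⧸ I t) (M ⧸ (maximalIdeal R ^ n • ⊤ : Submodule R M)) :=
    htors.isScalarTower
  have := (hI t).2.isArtinianRing
  have hirr := infIrred_bot_quotient (hI t).1
  have : Nontrivial (R ⧸ I t) := Ideal.Quotient.nontrivial_iff.2 fun h => (hI t).1.1 (h ▸ isMax_top)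
  have : IsLocalRing (R ⧸ I t) :=
    .of_surjective' (Ideal.Quotient.mk (I t)) Ideal.Quotient.mk_surjective
  obtain ⟨φ, hφ⟩ := exists_hom_self_apply_ne_zero hirr
    (y := (Submodule.Quotient.mk (r • z) : M ⧸ (maximalIdeal R ^ n • ⊤ : Submodule R M)))
    fun h => hmem ((Submodule.Quotient.mk_eq_zero _).1 h)
  refine hφ ?_
  have := smul_lic_bot_quotient_eq_zero hr
    (map_lic_bot_le (φ.restrictScalars R ∘ₗ Submodule.mkQ _) hz)
  rw [← map_smul] at this
  exact this

end TestIdeals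

/-! ### Growth of the lengths of quotients by powers -/

section Length

variable {R : Type u} [CommRing R]

theorem length_range_le_of_ker_le {M N P : Type*} [AddCommGroup M] [Module R M] [AddCommGroup N]
    [Module R N] [AddCommGroup P] [Module R P] (f : M →ₗ[R] N) (g : M →ₗ[R] P)
    (h : LinearMap.ker f ≤ LinearMap.ker g) :
    Module.length R (LinearMap.range g) ≤ Module.length R (LinearMap.range f) := by
  rw [← f.quotKerEquivRange.length_eq, ← g.quotKerEquivRange.length_eq]
  exact Module.length_le_of_surjective (Submodule.factor h) (Submodule.factor_surjective h)

theorem length_quotient_eq_add {M : Type*} [AddCommGroup M] [Module R M] {A B : Submodule R M}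
    (h : A ≤ B) : Module.length R (M ⧸ A) =
      Module.length R (B.map A.mkQ) + Module.length R (M ⧸ B) := by
  rw [length_eq_length_submodule_add_length_quotient (B.map A.mkQ),
    (Submodule.quotientQuotientEquivQuotient A B h).length_eq]

/-- The linear combinations of the monomials of degree `n` in the family `a`. -/
noncomputable def monomialSum {σ : Type*} [Fintype σ] [DecidableEq σ] (a : σ → R) (n : ℕ) :
    (Sym σ n → R) →ₗ[R] R :=
  Fintype.linearCombination R fun s : Sym σ n => ((s : Multiset σ).map a).prod

variable {σ : Type*} [Fintype σ] [DecidableEq σ]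

theorem range_monomialSum (a : σ → R) (n : ℕ) :
    LinearMap.range (monomialSum a n) = Ideal.span (Set.range a) ^ n := by
  rw [monomialSum, Fintype.range_linearCombination]
  change Ideal.span _ = _
  induction n with
  | zero =>
    rw [pow_zero, Ideal.one_eq_top, Ideal.eq_top_iff_one]
    exact Ideal.subset_span ⟨Sym.nil, by simp⟩
  | succ n ih =>
    rw [pow_succ, ← ih, Ideal.span_mul_span']
    congr 1
    ext x
    rw [Set.mem_mul]
    constructor
    · rintro ⟨s, rfl⟩
      obtain ⟨i, t, rfl⟩ := s.exists_eq_cons_of_succ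
      exact ⟨_, ⟨t, rfl⟩, a i, ⟨i, rfl⟩,
        by simp only [Sym.coe_cons, Multiset.map_cons, Multiset.prod_cons, mul_comm]⟩
    · rintro ⟨_, ⟨s, rfl⟩, _, ⟨i, rfl⟩, rfl⟩
      exact ⟨i ::ₛ s, by
        simp only [Sym.coe_cons, Multiset.map_cons, Multiset.prod_cons, mul_comm]⟩

theorem length_quotient_pow_succ (a : σ → R) (n : ℕ) :
    Module.length R (R ⧸ Ideal.span (Set.range a) ^ (n + 1)) =
      Module.length R (LinearMap.range
        ((Submodule.mkQ (Ideal.span (Set.range a) ^ (n + 1))) ∘ₗ monomialSum a n)) +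
      Module.length R (R ⧸ Ideal.span (Set.range a) ^ n) := by
  rw [LinearMap.range_comp, range_monomialSum]
  exact length_quotient_eq_add (Ideal.pow_le_pow_right n.le_succ)

/-- With `J` the span of `a`, each `J ^ i / J ^ (i + 1)` is spanned by the monomials of degree `i`
and killed by `J`, so it is a quotient of a power of `R ⧸ J`. -/
theorem length_quotient_pow_le (a : σ → R) (n : ℕ) :
    Module.length R (R ⧸ Ideal.span (Set.range a) ^ n) ≤
      (∑ i ∈ Finset.range n, (Fintype.card σ).multichoose i : ℕ) *
        Module.length R (R ⧸ Ideal.span (Set.range a)) := by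
  induction n with
  | zero =>
    have : Subsingleton (R ⧸ Ideal.span (Set.range a) ^ 0) := by
      rw [pow_zero, Ideal.one_eq_top]
      exact Submodule.Quotient.subsingleton_iff.2 rfl
    simp
  | succ n ih =>
    rw [length_quotient_pow_succ, Finset.sum_range_succ, Nat.cast_add, add_mul, add_comm]
    refine add_le_add ih ?_
    let C : (Sym σ n → R) →ₗ[R] (Sym σ n → R ⧸ Ideal.span (Set.range a)) :=
      LinearMap.pi fun s => Submodule.mkQ _ ∘ₗ LinearMap.proj s
    have hC : LinearMap.ker C ≤ LinearMap.ker
        ((Submodule.mkQ (Ideal.span (Set.range a) ^ (n + 1))) ∘ₗ monomialSum a n) := by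
      intro v hv
      rw [LinearMap.mem_ker, LinearMap.comp_apply, Submodule.mkQ_apply,
        Submodule.Quotient.mk_eq_zero, monomialSum, Fintype.linearCombination_apply]
      refine sum_mem fun s _ => ?_
      have h1 : v s ∈ Ideal.span (Set.range a) :=
        (Submodule.Quotient.mk_eq_zero _).1 (congrFun hv s)
      rw [pow_succ', smul_eq_mul]
      refine Ideal.mul_mem_mul h1 ?_
      rw [← range_monomialSum]
      exact ⟨Pi.single s 1, by simp [monomialSum]⟩
    refine (length_range_le_of_ker_le _ _ hC).trans
      ((Module.length_le_of_injective _ (Submodule.subtype_injective _)).trans ?_)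
    rw [Module.length_pi, ← Sym.card_sym_eq_multichoose]
    simp

/-- If no form in `a` with a nonzero residue vanishes, the powers of the ideal generated by `a`
have maximal growth. -/
theorem sum_multichoose_le_length_quotient_pow [IsLocalRing R] (a : σ → R)
    (ha : ∀ i, a i ∈ maximalIdeal R)
    (hind : ∀ n, ∀ v : Sym σ n → R, monomialSum a n v = 0 → ∀ s, v s ∈ maximalIdeal R) (n : ℕ) :
    (∑ i ∈ Finset.range n, (Fintype.card σ).multichoose i : ℕ) ≤
      Module.length R (R ⧸ Ideal.span (Set.range a) ^ n) := by
  induction n with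
  | zero => simp
  | succ n ih =>
    rw [length_quotient_pow_succ, Finset.sum_range_succ, Nat.cast_add, add_comm]
    refine add_le_add ?_ ih
    let C : (Sym σ n → R) →ₗ[R] (Sym σ n → R ⧸ maximalIdeal R) :=
      LinearMap.pi fun s => Submodule.mkQ _ ∘ₗ LinearMap.proj s
    have hCmem : ∀ v, (∀ s, v s ∈ maximalIdeal R) → v ∈ LinearMap.ker C := fun v hv =>
      funext fun s => (Submodule.Quotient.mk_eq_zero _).2 (hv s)
    have hJ : Ideal.span (Set.range a) ≤ maximalIdeal R :=
      Ideal.span_le.2 (Set.range_subset_iff.2 ha)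
    -- A form whose value lies in `J ^ (n + 1) = J * J ^ n` agrees in value with a form `w` with
    -- coefficients in `J`; by `hind`, the difference has coefficients in the maximal ideal.
    have hker : LinearMap.ker
        ((Submodule.mkQ (Ideal.span (Set.range a) ^ (n + 1))) ∘ₗ monomialSum a n) ≤
        LinearMap.ker C := by
      intro v hv
      rw [LinearMap.mem_ker, LinearMap.comp_apply, Submodule.mkQ_apply,
        Submodule.Quotient.mk_eq_zero, pow_succ', ← range_monomialSum] at hv
      obtain ⟨w, hw, hwv⟩ :=
        (Submodule.map_smul'' (Ideal.span (Set.range a)) ⊤ (monomialSum a n)).ge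
          (by rwa [Submodule.map_top])
      have hwC : w ∈ LinearMap.ker C := by
        refine hCmem w fun s => ?_
        have : Ideal.span (Set.range a) • (⊤ : Submodule R (Sym σ n → R)) ≤
            Submodule.comap (LinearMap.proj (R := R) (φ := fun _ : Sym σ n => R) s)
              (maximalIdeal R) :=
          Submodule.smul_le.2 fun r hr m _ => Ideal.mul_mem_right _ _ (hJ hr)
        exact this hw
      have hvw : v - w ∈ LinearMap.ker C :=
        hCmem _ (hind n _ (by rw [map_sub, hwv, sub_self]))
      simpa using add_mem hvw hwC
    have hsurj : Function.Surjective C := by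
      intro y
      choose v hv using fun s => Submodule.Quotient.mk_surjective _ (y s)
      exact ⟨v, funext hv⟩
    refine le_trans ?_ (length_range_le_of_ker_le _ _ hker)
    rw [LinearMap.range_eq_top.2 hsurj, Module.length_top, Module.length_pi,
      ← Sym.card_sym_eq_multichoose]
    have : IsSimpleModule R (R ⧸ maximalIdeal R) :=
      isSimpleModule_iff_quot_maximal.2 ⟨_, maximalIdeal.isMaximal R, ⟨LinearEquiv.refl _ _⟩⟩
    rw [Module.length_eq_one]
    simp

end Length

/-! ### Reductions and integral closure -/

section Reduction

variable {R : Type u} [CommRing R]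

/-- If `J L ^ n = L ^ (n + 1)`, then `L` is contained in the integral closure of `J`. -/
theorem mem_idealClosure_of_pow_succ_le [IsNoetherianRing R] {J L : Ideal R} {n : ℕ}
    (h : L ^ (n + 1) ≤ J * L ^ n) {x : R} (hx : x ∈ L) : x ∈ idealClosure J := by
  rcases subsingleton_or_nontrivial R with hR | hR
  · exact ⟨1, one_pos, 0, by simp, Subsingleton.elim _ _⟩
  -- Cayley–Hamilton for multiplication by `x` on `L ^ n`, which maps it into `J * L ^ n`.
  obtain ⟨p, hp, -, hc, hpx⟩ :=
    LinearMap.exists_monic_and_natDegree_eq_and_coeff_mem_pow_and_aeval_eq_zero R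
      (algebraMap R (Module.End R (L ^ n : Ideal R)) x) J (by
        rintro _ ⟨y, rfl⟩
        have hxy : x * (y : R) ∈ J • (L ^ n : Ideal R) :=
          h (by rw [pow_succ']; exact Ideal.mul_mem_mul hx y.2)
        have hmap : (J • (⊤ : Submodule R (L ^ n : Ideal R))).map (L ^ n : Ideal R).subtype =
            J • (L ^ n : Ideal R) := by
          rw [Submodule.map_smul'', Submodule.map_subtype_top]
        rw [← hmap] at hxy
        obtain ⟨z, hz, hzy⟩ := hxy
        have hz' : z = algebraMap R (Module.End R (L ^ n : Ideal R)) x y := Subtype.ext hzy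
        rwa [← hz'])
  rw [Polynomial.aeval_algebraMap_apply] at hpx
  have heval : p.eval x * x ^ n = 0 :=
    congr(($hpx ⟨x ^ n, Ideal.pow_mem_pow hx n⟩ : (L ^ n : Ideal R)).1)
  have hdeg : (p * Polynomial.X ^ (n + 1)).natDegree = p.natDegree + (n + 1) := by
    rw [hp.natDegree_mul (Polynomial.monic_X_pow _), Polynomial.natDegree_X_pow]
  -- `p(x)` kills `x ^ n`; one further factor of `x` keeps the degree positive even when `p = 1` and
  -- `n = 0`.
  refine mem_idealClosure_of_sum_eq_zero (n := p.natDegree + (n + 1)) (by omega)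
    (p * Polynomial.X ^ (n + 1)).coeff ?_ (fun i _ => ?_) ?_
  · rw [Polynomial.coeff_mul_X_pow, hp.coeff_natDegree]
  · rw [Polynomial.coeff_mul_X_pow']
    split_ifs with hi
    · rw [show p.natDegree + (n + 1) - i = p.natDegree - (i - (n + 1)) by omega]
      exact hc _
    · exact zero_mem _
  · rw [← hdeg, ← Polynomial.eval_eq_sum_range, Polynomial.eval_mul, Polynomial.eval_pow,
      Polynomial.eval_X, pow_succ, ← mul_assoc, heval, zero_mul]

theorem sup_span_singleton_pow_succ_le (I : Ideal R) (x : R) (k : ℕ) :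
    (I ⊔ Ideal.span {x}) ^ (k + 1) ≤
      I * (I ⊔ Ideal.span {x}) ^ k ⊔ Ideal.span {x ^ (k + 1)} := by
  set L := I ⊔ Ideal.span {x}
  induction k with
  | zero => simp [L]
  | succ k ih =>
    calc L ^ (k + 1 + 1) = (I ⊔ Ideal.span {x}) * L ^ (k + 1) := pow_succ' _ _
      _ = I * L ^ (k + 1) ⊔ Ideal.span {x} * L ^ (k + 1) := Ideal.sup_mul _ _ _
      _ ≤ I * L ^ (k + 1) ⊔ Ideal.span {x} * (I * L ^ k ⊔ Ideal.span {x ^ (k + 1)}) := by gcongr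
      _ = I * L ^ (k + 1) ⊔ (I * (Ideal.span {x} * L ^ k) ⊔ Ideal.span {x ^ (k + 1 + 1)}) := by
        rw [Ideal.mul_sup, Ideal.span_singleton_mul_span_singleton, ← pow_succ', mul_left_comm]
      _ ≤ I * L ^ (k + 1) ⊔ (I * (L * L ^ k) ⊔ Ideal.span {x ^ (k + 1 + 1)}) := by
        gcongr
        exact le_sup_right
      _ = I * L ^ (k + 1) ⊔ Ideal.span {x ^ (k + 1 + 1)} := by
        rw [← pow_succ', ← sup_assoc, sup_idem]

/-- In the expansion of the power only the pure power of `x` lacks a factor from `I`, and the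
integral equation rewrites it. -/
theorem pow_succ_le_of_mem_idealClosure {I : Ideal R} {x : R} (hx : x ∈ idealClosure I) :
    ∃ n, (I ⊔ Ideal.span {x}) ^ (n + 1) ≤ I * (I ⊔ Ideal.span {x}) ^ n := by
  obtain ⟨n, hn, a, ha, h⟩ := hx
  obtain ⟨n, rfl⟩ := Nat.exists_eq_succ_of_ne_zero hn.ne'
  set L := I ⊔ Ideal.span {x}
  have hxL : x ∈ L := Ideal.mem_sup_right (Ideal.mem_span_singleton_self x)
  have hIL : I ≤ L := le_sup_left
  have hxn : x ^ (n + 1) ∈ I * L ^ n := by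
    rw [eq_neg_of_add_eq_zero_left h]
    refine neg_mem (sum_mem fun i hi => ?_)
    obtain ⟨i, rfl⟩ := Nat.exists_eq_succ_of_ne_zero
      (Nat.one_le_iff_ne_zero.1 (Finset.mem_Icc.1 hi).1)
    have hin : i ≤ n := Nat.le_of_succ_le_succ (Finset.mem_Icc.1 hi).2
    have h1 := ha _ hi
    rw [Nat.succ_eq_add_one, pow_succ'] at h1
    have h2 : x ^ (n.succ - i.succ) ∈ L ^ (n - i) := by
      rw [Nat.succ_sub_succ]
      exact Ideal.pow_mem_pow hxL _
    have h3 : I * I ^ i * L ^ (n - i) ≤ I * L ^ n := by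
      calc I * I ^ i * L ^ (n - i) ≤ I * L ^ i * L ^ (n - i) := by gcongr
        _ = I * L ^ n := by rw [mul_assoc, ← pow_add, Nat.add_sub_cancel' hin]
    exact h3 (Ideal.mul_mem_mul h1 h2)
  refine ⟨n, ?_⟩
  exact (sup_span_singleton_pow_succ_le I x n).trans
    (sup_le le_rfl ((Ideal.span_singleton_le_iff_mem _).2 hxn))

/-- Reductions compose: `I` is a reduction of `I + (x)`, so the relation between `J` and `I` carries
over to `J` and `I + (x)`. -/
theorem idealClosure_subset_of_reduction [IsNoetherianRing R] {J I : Ideal R} {n : ℕ}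
    (h : I ^ (n + 1) ≤ J * I ^ n) : idealClosure I ⊆ idealClosure J := by
  intro x hx
  obtain ⟨m, hm⟩ := pow_succ_le_of_mem_idealClosure hx
  set L := I ⊔ Ideal.span {x}
  have hxL : x ∈ L := Ideal.mem_sup_right (Ideal.mem_span_singleton_self x)
  have hk : ∀ k, L ^ (m + k) ≤ I ^ k * L ^ m := by
    intro k
    induction k with
    | zero => simp
    | succ k ih =>
      calc L ^ (m + (k + 1)) = L * L ^ (m + k) := by rw [← pow_succ']; rfl
        _ ≤ L * (I ^ k * L ^ m) := by gcongr
        _ = I ^ k * L ^ (m + 1) := by rw [mul_left_comm, ← pow_succ']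
        _ ≤ I ^ k * (I * L ^ m) := by gcongr
        _ = I ^ (k + 1) * L ^ m := by rw [← mul_assoc, ← pow_succ]
  refine mem_idealClosure_of_pow_succ_le (n := m + n) ?_ hxL
  calc L ^ (m + n + 1) ≤ I ^ (n + 1) * L ^ m := hk (n + 1)
    _ ≤ J * I ^ n * L ^ m := by gcongr
    _ ≤ J * L ^ n * L ^ m := by
      gcongr
      exact le_sup_left
    _ = J * L ^ (m + n) := by rw [mul_assoc, ← pow_add, add_comm]

/-- Telescoping: the factors `x i` are replaced by `y i` one at a time. -/
theorem prod_map_sub_prod_map_mem {σ : Type*} {J L : Ideal R} {x y : σ → R} (hx : ∀ i, x i ∈ J)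
    (hy : ∀ i, y i ∈ J) (hxy : ∀ i, x i - y i ∈ L) (s : Multiset σ) (n : ℕ)
    (hs : Multiset.card s = n + 1) :
    (s.map x).prod - (s.map y).prod ∈ L * J ^ n := by
  have hpow : ∀ t : Multiset σ, (t.map x).prod ∈ J ^ (Multiset.card t) := by
    intro t
    induction t using Multiset.induction_on with
    | empty => simp
    | cons i t ih =>
      rw [Multiset.map_cons, Multiset.prod_cons, Multiset.card_cons, pow_succ']
      exact Ideal.mul_mem_mul (hx i) ih
  induction n generalizing s with
  | zero =>
    obtain ⟨i, rfl⟩ := Multiset.card_eq_one.1 hs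
    simpa using hxy i
  | succ n ih =>
    obtain ⟨i, hi⟩ := Multiset.card_pos_iff_exists_mem.1 (by omega : 0 < Multiset.card s)
    obtain ⟨t, rfl⟩ := Multiset.exists_cons_of_mem hi
    have ht : Multiset.card t = n + 1 := by simpa using hs
    rw [Multiset.map_cons, Multiset.map_cons, Multiset.prod_cons, Multiset.prod_cons]
    have h1 : (x i - y i) * (t.map x).prod ∈ L * J ^ (n + 1) :=
      Ideal.mul_mem_mul (hxy i) (ht ▸ hpow t)
    have h2 : y i * ((t.map x).prod - (t.map y).prod) ∈ L * J ^ (n + 1) := by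
      rw [pow_succ', mul_left_comm]
      exact Ideal.mul_mem_mul (hy i) (ih t ht)
    convert add_mem h1 h2 using 1
    ring

end Reduction

/-- In `n`, the left side grows with degree at most `d`, the right side with degree `l`. -/
theorem exists_sum_multichoose_mul_lt {d l : ℕ} (hdl : d < l) (e c : ℕ) :
    ∃ n, (∑ i ∈ Finset.range (e * n), d.multichoose i) * c <
      ∑ i ∈ Finset.range n, l.multichoose i := by
  -- Chosen so that, after multiplication by `l!`, the left side is at most `m * (m + 1) ^ d` and
  -- the right side at least `(m + 1) ^ (d + 1)`.
  set m := l.factorial * ((e + d) ^ d * c) with hm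
  refine ⟨m + 1, ?_⟩
  have h1 : ∑ i ∈ Finset.range (e * (m + 1)), d.multichoose i ≤ (e + d) ^ d * (m + 1) ^ d := by
    calc ∑ i ∈ Finset.range (e * (m + 1)), d.multichoose i
        ≤ ∑ i ∈ Finset.range (e * (m + 1) + 1), d.multichoose i :=
          Finset.sum_le_sum_of_subset (Finset.range_mono (Nat.le_succ _))
      _ = (e * (m + 1) + d).choose d := Nat.sum_range_multichoose _ _
      _ ≤ (e * (m + 1) + d) ^ d := Nat.choose_le_pow _ _
      _ ≤ ((e + d) * (m + 1)) ^ d := by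
          gcongr
          nlinarith
      _ = (e + d) ^ d * (m + 1) ^ d := mul_pow _ _ _
  have h2 : (m + 1) ^ (d + 1) ≤ l.factorial * ∑ i ∈ Finset.range (m + 1), l.multichoose i := by
    rw [Nat.sum_range_multichoose, ← Nat.ascFactorial_eq_factorial_mul_choose]
    exact (Nat.pow_le_pow_right (Nat.succ_pos m) hdl).trans (Nat.pow_succ_le_ascFactorial _ _)
  refine Nat.lt_of_mul_lt_mul_left (a := l.factorial) (lt_of_lt_of_le ?_ h2)
  calc l.factorial * ((∑ i ∈ Finset.range (e * (m + 1)), d.multichoose i) * c)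
      ≤ l.factorial * ((e + d) ^ d * (m + 1) ^ d * c) := by gcongr
    _ = m * (m + 1) ^ d := by rw [hm]; ring
    _ < (m + 1) * (m + 1) ^ d := by gcongr; omega
    _ = (m + 1) ^ (d + 1) := (pow_succ' _ _).symm

/-! ### Parameter reductions over an infinite residue field -/

section Reduction

variable {R : Type u} [CommRing R] [IsLocalRing R]

/-- More than `dim R` generators of an ideal primary to the maximal ideal satisfy a homogeneous
relation with a unit coefficient. -/
theorem exists_monomialSum_eq_zero [IsNoetherianRing R] {σ τ : Type*} [Fintype σ]
    [DecidableEq σ] [Fintype τ] [DecidableEq τ] {a : σ → R} {q : τ → R} (ha : IsMPrimary (Ideal.span (Set.range a)))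
    (hq : maximalIdeal R ∈ (Ideal.span (Set.range q)).minimalPrimes)
    (hcard : Fintype.card τ < Fintype.card σ) :
    ∃ n, ∃ v : Sym σ n → R, monomialSum a n v = 0 ∧ ∃ s, v s ∉ maximalIdeal R := by
  by_contra! hind
  set J := Ideal.span (Set.range a) with hJ
  set Q := Ideal.span (Set.range q) with hQ
  have := ha.isArtinianRing
  obtain ⟨e, he⟩ := exists_maximalIdeal_pow_le_of_isArtinianRing_quotient J
  have hfin : Module.length R (R ⧸ Q) ≠ ⊤ := by
    have := quotient_artinian_of_mem_minimalPrimes_of_isLocalRing Q hq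
    exact Module.length_ne_top_iff.2 (isFiniteLength_iff_isNoetherian_isArtinian.2 ⟨inferInstance,
      isArtinian_of_surjective_algebraMap (R := R ⧸ Q) Ideal.Quotient.mk_surjective⟩)
  obtain ⟨c, hc⟩ := ENat.ne_top_iff_exists.1 hfin
  obtain ⟨n, hn⟩ := exists_sum_multichoose_mul_lt hcard e c
  -- This bounds the length modulo `J ^ n` by growth of degree at most `card τ`, while independence
  -- of the monomials would force degree `card σ`.
  have hle : Q ^ (e * n) ≤ J ^ n := by
    calc Q ^ (e * n) ≤ maximalIdeal R ^ (e * n) := Ideal.pow_right_mono hq.1.2 _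
      _ = (maximalIdeal R ^ e) ^ n := pow_mul _ _ _
      _ ≤ J ^ n := Ideal.pow_right_mono he _
  have ham : ∀ i, a i ∈ maximalIdeal R := fun i =>
    ha.2 ▸ Ideal.le_radical (Ideal.subset_span ⟨i, rfl⟩)
  have h1 := sum_multichoose_le_length_quotient_pow a ham hind n
  have h2 := length_quotient_pow_le q (e * n)
  have h3 : Module.length R (R ⧸ J ^ n) ≤ Module.length R (R ⧸ Q ^ (e * n)) :=
    Module.length_le_of_surjective (Submodule.factor hle) (Submodule.factor_surjective hle)
  have h4 := h1.trans (h3.trans h2)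
  rw [← hQ, ← hc] at h4
  exact absurd (by exact_mod_cast h4) hn.not_ge

/-- The residue of the form is a nonzero polynomial over an infinite field, so it is nonzero at some
point, which is lifted to `R`. -/
theorem exists_isUnit_monomialSum [Infinite (ResidueField R)] {σ : Type*} [Fintype σ]
    [DecidableEq σ] {n : ℕ} {v : Sym σ n → R} {s : Sym σ n} (hs : v s ∉ maximalIdeal R) :
    ∃ c : σ → R, IsUnit (monomialSum c n v) := by
  let f : MvPolynomial σ (ResidueField R) :=
    ∑ s : Sym σ n, MvPolynomial.monomial (Multiset.toFinsupp (s : Multiset σ)) (residue R (v s))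
  have hf : f ≠ 0 := by
    intro h0
    have := congr(MvPolynomial.coeff (Multiset.toFinsupp (s : Multiset σ)) $h0)
    rw [MvPolynomial.coeff_sum, Finset.sum_eq_single s] at this
    · rw [MvPolynomial.coeff_monomial, if_pos rfl, MvPolynomial.coeff_zero,
        residue_eq_zero_iff] at this
      exact hs this
    · intro t _ ht
      rw [MvPolynomial.coeff_monomial, if_neg]
      exact fun h => ht (Sym.coe_injective (Multiset.toFinsupp.injective h))
    · simp
  obtain ⟨cbar, hcbar⟩ : ∃ c, MvPolynomial.eval c f ≠ 0 := by
    by_contra! h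
    exact hf (MvPolynomial.funext fun c => by rw [h c, map_zero])
  choose c hc using fun i => residue_surjective (R := R) (cbar i)
  refine ⟨c, ?_⟩
  by_contra hu
  refine hcbar ?_
  have := (residue_eq_zero_iff _).2 ((mem_maximalIdeal _).2 hu)
  rw [← this, monomialSum, Fintype.linearCombination_apply, map_sum, map_sum]
  refine Finset.sum_congr rfl fun t _ => ?_
  rw [MvPolynomial.eval_monomial, smul_eq_mul, map_mul, map_multiset_prod, Multiset.map_map]
  congr 1
  rw [Finsupp.prod, Multiset.toFinsupp_support, Finset.prod_multiset_map_count]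
  refine Finset.prod_congr rfl fun i _ => ?_
  rw [Multiset.toFinsupp_apply, Function.comp_apply, hc]

/-- As in Noether normalisation, `c` is a point where the form is a unit and `c j` is a unit. With
`t = a j / c j` and `b i = a i - c i * t`, the vanishing form at `a` is congruent to a unit times `t
^ (n + 1)` modulo `B * J ^ n`, where `J = B + (t)`. -/
theorem exists_reduction_of_monomialSum_eq_zero [Infinite (ResidueField R)] {σ : Type*}
    [Fintype σ] [DecidableEq σ] {a : σ → R} {n : ℕ} {v : Sym σ n → R}
    (hv : monomialSum a n v = 0) {s : Sym σ n} (hs : v s ∉ maximalIdeal R) :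
    ∃ (j : σ) (b : {i // i ≠ j} → R) (m : ℕ),
      Ideal.span (Set.range b) ≤ Ideal.span (Set.range a) ∧
      Ideal.span (Set.range a) ^ (m + 1) ≤
        Ideal.span (Set.range b) * Ideal.span (Set.range a) ^ m := by
  set J := Ideal.span (Set.range a) with hJ
  have haJ : ∀ i, a i ∈ J := fun i => Ideal.subset_span ⟨i, rfl⟩
  obtain ⟨c, hc⟩ := exists_isUnit_monomialSum hs
  cases n with
  | zero =>
    -- A vanishing form of degree zero has zero as its only coefficient.
    refine absurd ?_ hs
    rw [monomialSum, Fintype.linearCombination_apply, Fintype.sum_eq_single s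
      (fun t ht => (ht (Subsingleton.elim t s)).elim), Subsingleton.elim s Sym.nil] at hv
    rw [Subsingleton.elim s Sym.nil]
    simp at hv
    simp [hv]
  | succ n =>
    obtain ⟨j, hj⟩ : ∃ j, IsUnit (c j) := by
      by_contra! h
      refine (mem_maximalIdeal _).1 ?_ hc
      rw [monomialSum, Fintype.linearCombination_apply]
      refine sum_mem fun t _ => Ideal.mul_mem_left _ _ ?_
      obtain ⟨i, t, rfl⟩ := t.exists_eq_cons_of_succ
      rw [Sym.coe_cons, Multiset.map_cons, Multiset.prod_cons]
      exact Ideal.mul_mem_right _ _ ((mem_maximalIdeal _).2 (h i))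
    obtain ⟨w, hw⟩ := hj.exists_right_inv
    set t := w * a j with ht
    have htJ : t ∈ J := Ideal.mul_mem_left _ _ (haJ j)
    let b : {i // i ≠ j} → R := fun i => a i - c i * t
    set B := Ideal.span (Set.range b) with hB
    have hBJ : B ≤ J := by
      refine Ideal.span_le.2 (Set.range_subset_iff.2 fun i => ?_)
      exact sub_mem (haJ i) (Ideal.mul_mem_left _ _ htJ)
    have hab : ∀ i, a i - c i * t ∈ B := by
      intro i
      by_cases hi : i = j
      · subst hi
        rw [ht, ← mul_assoc, hw, one_mul, sub_self]
        exact zero_mem _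
      · exact Ideal.subset_span ⟨⟨i, hi⟩, rfl⟩
    have hsup : B ⊔ Ideal.span {t} = J := by
      refine le_antisymm (sup_le hBJ ((Ideal.span_singleton_le_iff_mem _).2 htJ)) ?_
      refine Ideal.span_le.2 (Set.range_subset_iff.2 fun i => ?_)
      rw [← sub_add_cancel (a i) (c i * t)]
      exact add_mem (Ideal.mem_sup_left (hab i)) (Ideal.mem_sup_right
        (Ideal.mul_mem_left _ _ (Ideal.mem_span_singleton_self t)))
    have hmon : monomialSum a (n + 1) v - monomialSum c (n + 1) v * t ^ (n + 1) ∈ B * J ^ n := by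
      simp only [monomialSum, Fintype.linearCombination_apply, Finset.sum_mul, smul_eq_mul]
      rw [← Finset.sum_sub_distrib]
      refine sum_mem fun r _ => ?_
      have h1 := prod_map_sub_prod_map_mem haJ
        (fun i => Ideal.mul_mem_left _ (c i) htJ) hab (r : Multiset σ) n r.2
      rw [Multiset.prod_map_mul, Multiset.map_const', Multiset.prod_replicate] at h1
      rw [show Multiset.card (r : Multiset σ) = n + 1 from r.2] at h1
      rw [mul_assoc, ← mul_sub]
      exact Ideal.mul_mem_left _ _ h1
    rw [hv, zero_sub, neg_mem_iff] at hmon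
    have htn : t ^ (n + 1) ∈ B * J ^ n := (Ideal.unit_mul_mem_iff_mem _ hc).1 hmon
    refine ⟨j, b, n, hBJ, ?_⟩
    have := sup_span_singleton_pow_succ_le B t n
    rw [hsup] at this
    exact this.trans (sup_le le_rfl ((Ideal.span_singleton_le_iff_mem _).2 htn))

theorem IsMPrimary.of_pow_le {I J : Ideal R} (hJ : IsMPrimary J) (hIJ : I ≤ J) {n : ℕ}
    (h : J ^ n ≤ I) : IsMPrimary I := by
  have hrad : I.radical = maximalIdeal R := by
    rw [← hJ.2]
    refine le_antisymm (Ideal.radical_mono hIJ) ?_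
    rintro x ⟨k, hk⟩
    exact ⟨k * n, h (by rw [pow_mul]; exact Ideal.pow_mem_pow hk n)⟩
  exact ⟨Ideal.isPrimary_of_isMaximal_radical (by rw [hrad]; exact maximalIdeal.isMaximal R), hrad⟩

/-- Over an infinite residue field, an ideal primary to the maximal ideal has the same integral
closure as some parameter ideal contained in it. -/
theorem exists_parameter_idealClosure_subset [IsNoetherianRing R]
    [Infinite (ResidueField R)] {τ : Type*}
    [Fintype τ] [DecidableEq τ] {q : τ → R}
    (hq : maximalIdeal R ∈ (Ideal.span (Set.range q)).minimalPrimes) (k : ℕ) :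
    ∀ {σ : Type v} [Fintype σ] [DecidableEq σ] {a : σ → R},
      Fintype.card σ = Fintype.card τ + k → IsMPrimary (Ideal.span (Set.range a)) →
      ∃ b : Fin (Fintype.card τ) → R, IsMPrimary (Ideal.span (Set.range b)) ∧
        Ideal.span (Set.range b) ≤ Ideal.span (Set.range a) ∧
        idealClosure (Ideal.span (Set.range a)) ⊆ idealClosure (Ideal.span (Set.range b)) := by
  induction k with
  | zero =>
    intro σ _ _ a hcard ha
    let e : Fin (Fintype.card τ) ≃ σ := (Fintype.equivFinOfCardEq hcard).symm
    have : Set.range (a ∘ e) = Set.range a := e.surjective.range_comp a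
    exact ⟨a ∘ e, by rwa [this], by rw [this], by rw [this]⟩
  | succ k ih =>
    intro σ _ _ a hcard ha
    obtain ⟨n, v, hv, s, hs⟩ := exists_monomialSum_eq_zero ha hq (by omega)
    obtain ⟨j, b, m, hle, hred⟩ := exists_reduction_of_monomialSum_eq_zero hv hs
    have hb := ha.of_pow_le hle (hred.trans Ideal.mul_le_left)
    obtain ⟨b', hb', hle', hcl⟩ := ih (a := b) (by
      rw [Fintype.card_subtype_compl, Fintype.card_subtype_eq]
      omega) hb
    exact ⟨b', hb', hle'.trans hle, (idealClosure_subset_of_reduction hred).trans hcl⟩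

theorem tauI_le_iInf_parameter :
    tauI R ≤ ⨅ (J : Ideal R) (_ : IsMPrimaryParameterIdeal J), J.colon (idealClosure J) :=
  le_iInf fun J => le_iInf fun _ => iInf_le _ J

theorem tauI_eq_iInf_parameter [IsNoetherianRing R] [Infinite (ResidueField R)] :
    tauI R = ⨅ (J : Ideal R) (_ : IsMPrimaryParameterIdeal J), J.colon (idealClosure J) := by
  classical
  refine le_antisymm tauI_le_iInf_parameter fun r hr => ?_
  simp only [Submodule.mem_iInf, Submodule.mem_colon, smul_eq_mul] at hr
  rw [tauI_eq_iInf_isMPrimary]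
  simp only [Submodule.mem_iInf, Submodule.mem_colon, smul_eq_mul]
  intro I hI x hx
  obtain ⟨t, ht, hcard⟩ := (maximalIdeal R).exists_finset_card_eq_height_of_isNoetherianRing
  have hdim : ringKrullDim R = (Fintype.card t : ℕ) := by
    rw [← maximalIdeal_height_eq_ringKrullDim, ← hcard, Fintype.card_coe]
    rfl
  have hq : maximalIdeal R ∈ (Ideal.span (Set.range (Subtype.val : t → R))).minimalPrimes := by
    simpa using ht
  obtain ⟨l, a, ha⟩ := Submodule.fg_iff_exists_fin_generating_family.1 (IsNoetherian.noetherian I)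
  -- Padding by `dim R` zeros ensures at least `dim R` generators, with surplus exactly `l`.
  have hspan : Ideal.span (Set.range (Sum.elim (0 : t → R) a)) = I := by
    rw [Set.Sum.elim_range]
    refine le_antisymm (Ideal.span_le.2 (Set.union_subset ?_ ?_)) ?_
    · rintro _ ⟨_, rfl⟩
      exact zero_mem _
    · exact ha ▸ Submodule.subset_span
    · exact ha.ge.trans (Submodule.span_mono Set.subset_union_right)
  obtain ⟨b, hb, hle, hcl⟩ := exists_parameter_idealClosure_subset hq l
    (a := Sum.elim (0 : t → R) a) (by simp) (by rwa [hspan])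
  rw [hspan] at hle hcl
  exact hle (hr _ ⟨hb, _, b, hdim, rfl⟩ x (hcl hx))

end Reduction

end LiftableClosure

theorem mainTheorem7 (R : Type u) [CommRing R] [IsLocalRing R] [IsNoetherianRing R] :
    -- the descriptions of `τ_M`, which is defined through all artinian modules
    (LiftableClosure.tauM R =
        ⨅ (M : Type u) (_ : AddCommGroup M) (_ : Module R M) (_ : IsFiniteLength R M),
          (LiftableClosure.lic (⊥ : Submodule R M)).annihilator) ∧
    (LiftableClosure.tauM R =
        ⨅ (M : Type u) (_ : AddCommGroup M) (_ : Module R M) (_ : Module.Finite R M),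
          (LiftableClosure.lic (⊥ : Submodule R M)).annihilator) ∧
    (∀ (E : Type u) [AddCommGroup E] [Module R E] (f : IsLocalRing.ResidueField R →ₗ[R] E),
        LiftableClosure.IsInjectiveHull f →
          LiftableClosure.tauM R = (LiftableClosure.lic (⊥ : Submodule R E)).annihilator) ∧
    -- the descriptions of `τ_I`, which is defined through all ideals
    (LiftableClosure.tauI R =
        ⨅ (I : Ideal R) (_ : LiftableClosure.IsMPrimary I),
          I.colon (LiftableClosure.idealClosure I)) ∧
    (LiftableClosure.tauI R ≤
        ⨅ (J : Ideal R) (_ : LiftableClosure.IsMPrimaryParameterIdeal J),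
          J.colon (LiftableClosure.idealClosure J)) ∧
    (Infinite (IsLocalRing.ResidueField R) →
      LiftableClosure.tauI R =
        ⨅ (J : Ideal R) (_ : LiftableClosure.IsMPrimaryParameterIdeal J),
          J.colon (LiftableClosure.idealClosure J)) ∧
    -- the comparison of `τ_M` with `τ_I`
    LiftableClosure.tauM R ≤ LiftableClosure.tauI R ∧
    (ringKrullDim R = 0 ∨ LiftableClosure.IsApproximatelyGorenstein R →
      LiftableClosure.tauM R = LiftableClosure.tauI R) := by
  refine ⟨LiftableClosure.tauM_eq_iInf fun _ _ _ h => h,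
    LiftableClosure.tauM_eq_iInf fun M _ _ h => ?_,
    fun E _ _ f hf => LiftableClosure.tauM_eq_annihilator_injectiveHull hf,
    LiftableClosure.tauI_eq_iInf_isMPrimary, LiftableClosure.tauI_le_iInf_parameter,
    fun _ => LiftableClosure.tauI_eq_iInf_parameter, LiftableClosure.tauM_le_tauI,
    fun h => LiftableClosure.tauM_le_tauI.antisymm (h.elim
      LiftableClosure.tauI_le_tauM_of_ringKrullDim_eq_zero
      LiftableClosure.tauI_le_tauM_of_isApproximatelyGorenstein)⟩
  have := (isFiniteLength_iff_isNoetherian_isArtinian.1 h).1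
  infer_instance
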